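/- Let $n,p$ be positive integers, $\delta_0\in(0,1)$ and $\sigma>0$. Let $\xi=(\xi_1,\dots,\xi_n)$ be a random vector whose components are independent real random variables with mean zero and $$\mathbb E\exp(\xi_i^2/\sigma^2)\le e,\qquad i=1,\dots,n.$$ For $v\in\mathbb R^n$ put $\|v\|_n=\big(\frac1n\sum_{i=1}^n v_i^2\big)^{1/2}$, and for $u\in\mathbb R^p$ let $u_1^\sharp\ge\dots\ge u_p^\sharp$ be the non-increasing rearrangement of $|u_1|,\dots,|u_p|$. Let $X\in\mathbb R^{n\times p}$ be a deterministic matrix with $\max_{j=1,\dots,p}\|Xe_j\|_n\le 1$, where $(e_1,\dots,e_p)$ is the canonical basis of $\mathbb R^p$. Then, with probability at least $1-\delta_0$, the following inequality holds simultaneously for all $u\in\mathbb R^p$: $$\frac1n\,\xi^{T}Xu\;\le\;40\,\sigma\,\max\left(\sum_{j=1}^p u_j^\sharp\sqrt{\frac{\log(2p/j)}{n}}\,,\ \ \|Xu\|_n\,\frac{\sqrt{\pi/2}+\sqrt{2\log(1/\delta_0)}}{\sqrt n}\right).$$ -/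

import Mathlib

open MeasureTheory ProbabilityTheory
open scoped Matrix

/-- The empirical norm on `ℝⁿ`: `‖v‖ₙ² = (1/n) ∑ᵢ vᵢ²`. -/
noncomputable def empNorm {n : ℕ} (v : Fin n → ℝ) : ℝ :=
  Real.sqrt ((1 / (n : ℝ)) * ∑ i, v i ^ 2)

/-- The non-increasing rearrangement `(u₁♯, …, u_p♯)` of `(|u₁|, …, |u_p|)`: the sequence of
absolute values is composed with a permutation that sorts it in decreasing order.
Indices start at `0`, so `sharp u j` is `u♯` at position `j + 1`. -/
noncomputable def sharp {p : ℕ} (u : Fin p → ℝ) (j : Fin p) : ℝ :=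
  |u (Tuple.sort (fun i => -|u i|) j)|

theorem sharp_antitone {p : ℕ} (u : Fin p → ℝ) : Antitone (sharp u) := by
  intro i j hij
  have h := Tuple.monotone_sort (fun i => -|u i|) hij
  simpa [sharp] using h

theorem sharp_rearrangement {p : ℕ} (u : Fin p → ℝ) :
    ∃ π : Equiv.Perm (Fin p), sharp u = (fun i => |u i|) ∘ π :=
  ⟨Tuple.sort (fun i => -|u i|), rfl⟩

/-!
The proof is a PAC-Bayes argument. A centred variable with `E exp (ξ² / σ²) ≤ e` satisfies
`E exp (t ξ) ≤ exp (t² σ²)`, so by independence the weight `exp (⟨ξ, x⟩ - σ² |x|²)` has mean at most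
one for every fixed `x`. This remains true for every average of such weights over `x`; the average
used here is over the endpoints of a random walk of `k` steps whose law does not depend on `u` or
`ξ` (`walkPartition`). Markov's inequality and a union bound over `k`
(`ofReal_one_sub_le_measure_forall_le`) yield an event of probability at least `1 - δ` on which all
these averages are at most `2 ^ (k + 1) / δ`. The rest is deterministic on this event.

Given `u`, let a second walk have steps whose total mean is `X u`. By the Gibbs variational
inequality, applied step by step (`le_log_walkPartition`), `⟨ξ, X u⟩ - σ² |X u|²` is bounded by
`log (2 ^ (k + 1) / δ)` plus the relative entropy of the second walk with respect to the first, plus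
`σ²` times the sum of the second moments of its steps.

The steps of the prior walk are `±τ √(l + 1) X eᵢ`, where the column `i` is uniform and the level
`l` has weight `2 ^ (-(l + 1))`. The second walk picks the column carrying the `j`-th largest
`|uᵢ|`, always at the level `l ≈ log₂ (p / j)`, about `|uᵢ| / (τ √(l + 1))` times on average. As
the entropy of such a step is of order `l + 1` (`succ_mul_div_sqrt_rankLevel_le` replaces the
uniform weight `1 / p` by `1 / j`), with `τ` of order `1 / (σ √n)` the total entropy and `σ²` times
the total second moment are, up to an additive constant, of order `σ √n ∑ⱼ uⱼ♯ √(log (2p / j))`,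
which gives `dotProduct_mulVec_le_of_walkPartition_le`. Applying this to `t u` and choosing `t` so
that `t² σ² |X u|²` balances the constant term `3 log 2 + log (1 / δ)` gives the theorem.
-/

/-! ### Sub-Gaussian moment generating functions -/

theorem exp_le_add_exp_sq (x : ℝ) : Real.exp x ≤ x + Real.exp (x ^ 2) := by
  have hsq : x ^ 2 + 1 ≤ Real.exp (x ^ 2) := Real.add_one_le_exp _
  rcases le_or_gt |x| 1 with hx | hx
  · have h := (abs_le.1 (Real.abs_exp_sub_one_sub_id_le hx)).2
    linarith
  · rcases lt_abs.1 hx with h | h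
    · have : Real.exp x ≤ Real.exp (x ^ 2) := Real.exp_le_exp.2 (by nlinarith)
      linarith
    · have : Real.exp x ≤ 1 := Real.exp_le_one_iff.2 (by linarith)
      nlinarith

/-- The convexity bound `exp (r y) ≤ e ^ r (1 - r + r e⁻¹ exp y)`; it replaces Jensen's inequality
for the power `r ∈ [0, 1]` of a random variable with mean at most `e`. -/
theorem exp_mul_le_of_mem_Icc {r : ℝ} (h0 : 0 ≤ r) (h1 : r ≤ 1) (y : ℝ) :
    Real.exp (r * y) ≤ Real.exp r * (1 - r + r * (Real.exp y / Real.exp 1)) := by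
  have h := convexOn_exp.2 (Set.mem_univ (y - 1)) (Set.mem_univ 0) h0 (sub_nonneg.2 h1) (by ring)
  simp only [smul_eq_mul, mul_zero, add_zero, Real.exp_zero, mul_one] at h
  rw [Real.exp_sub] at h
  calc Real.exp (r * y) = Real.exp r * Real.exp (r * (y - 1)) := by
        rw [← Real.exp_add]; ring_nf
    _ ≤ _ := by gcongr; linarith

/-- A centred random variable with `E exp (ξ² / σ²) ≤ e` satisfies `E exp (t ξ) ≤ exp (t² σ²)`. -/
theorem hasSubgaussianMGF_of_lintegral_exp_sq_le {Ω : Type*} [MeasurableSpace Ω] {P : Measure Ω}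
    [IsProbabilityMeasure P] {ξ : Ω → ℝ} (hmeas : Measurable ξ) (hmean : ∫ ω, ξ ω ∂P = 0)
    {σ : ℝ} (hσ : 0 < σ)
    (hsubg : ∫⁻ ω, ENNReal.ofReal (Real.exp (ξ ω ^ 2 / σ ^ 2)) ∂P
      ≤ ENNReal.ofReal (Real.exp 1)) :
    HasSubgaussianMGF ξ (2 * Real.toNNReal (σ ^ 2)) P := by
  set Y : Ω → ℝ := fun ω => Real.exp (ξ ω ^ 2 / σ ^ 2) with hY
  have hYmeas : Measurable Y := by fun_prop
  have hYint : Integrable Y P := by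
    refine ⟨hYmeas.aestronglyMeasurable, ?_⟩
    rw [hasFiniteIntegral_iff_ofReal (ae_of_all _ fun ω => (Real.exp_pos _).le)]
    exact hsubg.trans_lt ENNReal.ofReal_lt_top
  have hYle : ∫ ω, Y ω ∂P ≤ Real.exp 1 := by
    rw [integral_eq_lintegral_of_nonneg_ae (ae_of_all _ fun ω => (Real.exp_pos _).le)
      hYmeas.aestronglyMeasurable]
    exact ENNReal.toReal_le_of_le_ofReal (Real.exp_pos _).le hsubg
  have hσ2 : 0 < σ ^ 2 := by positivity
  have hξint : Integrable ξ P := by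
    refine (hYint.const_mul σ).mono' hmeas.aestronglyMeasurable (ae_of_all _ fun ω => ?_)
    have h1 : ξ ω ^ 2 / σ ^ 2 + 1 ≤ Y ω := Real.add_one_le_exp _
    have h2 : |ξ ω| / σ ≤ (|ξ ω| / σ) ^ 2 + 1 := by nlinarith [sq_nonneg (|ξ ω| / σ - 1)]
    rw [div_pow, sq_abs] at h2
    rw [Real.norm_eq_abs, mul_comm]
    exact (div_le_iff₀ hσ).1 (h2.trans h1)
  -- Pointwise bounds of `exp (t ξ)` by affine functions of `ξ` and `Y`.
  have key : ∀ t : ℝ, ∃ a b c : ℝ, 0 ≤ b ∧ (∀ ω, Real.exp (t * ξ ω) ≤ c * ξ ω + (a + b * Y ω)) ∧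
      a + b * Real.exp 1 ≤ Real.exp (t ^ 2 * σ ^ 2) := by
    intro t
    set r := t ^ 2 * σ ^ 2 with hr
    have hr0 : 0 ≤ r := by positivity
    rcases le_or_gt r 1 with hr1 | hr1
    · refine ⟨Real.exp r * (1 - r), Real.exp r * r / Real.exp 1, t, by positivity, fun ω => ?_, ?_⟩
      · have h1 := exp_le_add_exp_sq (t * ξ ω)
        have h2 := exp_mul_le_of_mem_Icc hr0 hr1 (ξ ω ^ 2 / σ ^ 2)
        have h3 : r * (ξ ω ^ 2 / σ ^ 2) = (t * ξ ω) ^ 2 := by rw [hr]; field_simp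
        rw [h3] at h2
        calc _ ≤ t * ξ ω + Real.exp r *
              (1 - r + r * (Real.exp (ξ ω ^ 2 / σ ^ 2) / Real.exp 1)) := by linarith
          _ = _ := by simp only [hY]; ring
      · rw [div_mul_cancel₀ _ (Real.exp_pos 1).ne']
        exact le_of_eq (by ring)
    · refine ⟨Real.exp (r / 2 + 1 / 2) * (1 / 2),
        Real.exp (r / 2 + 1 / 2) * (1 / 2) / Real.exp 1, 0, by positivity, fun ω => ?_, ?_⟩
      · have h2 := exp_mul_le_of_mem_Icc (r := 1 / 2) (by norm_num) (by norm_num)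
          (ξ ω ^ 2 / σ ^ 2)
        have h3 : t * ξ ω ≤ r / 2 + 1 / 2 * (ξ ω ^ 2 / σ ^ 2) := by
          have h4 : r / 2 + 1 / 2 * (ξ ω ^ 2 / σ ^ 2) - t * ξ ω
              = (t * σ - ξ ω / σ) ^ 2 / 2 := by rw [hr]; field_simp; ring
          nlinarith [sq_nonneg (t * σ - ξ ω / σ)]
        calc Real.exp (t * ξ ω) ≤ Real.exp (r / 2) * Real.exp (1 / 2 * (ξ ω ^ 2 / σ ^ 2)) := by
              rw [← Real.exp_add]; exact Real.exp_le_exp.2 h3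
          _ ≤ _ := mul_le_mul_of_nonneg_left h2 (Real.exp_pos _).le
          _ = _ := by simp only [hY]; rw [Real.exp_add]; ring
      · rw [div_mul_cancel₀ _ (Real.exp_pos 1).ne', ← mul_add]
        norm_num
        linarith
  have hint : ∀ t : ℝ, Integrable (fun ω => Real.exp (t * ξ ω)) P := by
    intro t
    obtain ⟨a, b, c, -, h, -⟩ := key t
    refine ((hξint.const_mul c).add ((integrable_const a).add (hYint.const_mul b))).mono'
      (by fun_prop) (ae_of_all _ fun ω => ?_)
    rw [Real.norm_of_nonneg (Real.exp_pos _).le]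
    exact h ω
  refine ⟨hint, fun t => ?_⟩
  obtain ⟨a, b, c, hb, h, hab⟩ := key t
  have hint2 : Integrable (fun ω => a + b * Y ω) P := (integrable_const a).add (hYint.const_mul b)
  calc mgf ξ P t ≤ ∫ ω, (c * ξ ω + (a + b * Y ω)) ∂P :=
        integral_mono (hint t) ((hξint.const_mul c).add hint2) h
    _ = a + b * ∫ ω, Y ω ∂P := by
        rw [integral_add (hξint.const_mul c) hint2,
          integral_add (integrable_const a) (hYint.const_mul b), integral_const_mul,
          integral_const_mul, hmean]
        simp
    _ ≤ a + b * Real.exp 1 := by gcongr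
    _ ≤ Real.exp (t ^ 2 * σ ^ 2) := hab
    _ = _ := by
        congr 1
        push_cast
        rw [Real.coe_toNNReal _ hσ2.le]
        ring

/-- The exponential weight `exp (⟨ξ, x⟩ - σ² |x|²)` has mean at most one for every `x`. -/
theorem lintegral_exp_dotProduct_sub_le_one {Ω : Type*} [MeasurableSpace Ω] {P : Measure Ω}
    [IsProbabilityMeasure P] {n : ℕ} {ξ : Ω → Fin n → ℝ}
    (hmeas : ∀ i, Measurable fun ω => ξ ω i)
    (hindep : iIndepFun (fun (i : Fin n) (ω : Ω) => ξ ω i) P)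
    (hmean : ∀ i, ∫ ω, ξ ω i ∂P = 0) {σ : ℝ} (hσ : 0 < σ)
    (hsubg : ∀ i, ∫⁻ ω, ENNReal.ofReal (Real.exp (ξ ω i ^ 2 / σ ^ 2)) ∂P
      ≤ ENNReal.ofReal (Real.exp 1)) (x : Fin n → ℝ) :
    ∫⁻ ω, ENNReal.ofReal (Real.exp (ξ ω ⬝ᵥ x - σ ^ 2 * (x ⬝ᵥ x))) ∂P ≤ 1 := by
  have hind : iIndepFun (fun (i : Fin n) (ω : Ω) => x i * ξ ω i) P :=
    hindep.comp (fun i y => x i * y) fun i => measurable_const_mul (x i)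
  have hi : ∀ i, HasSubgaussianMGF (fun ω => x i * ξ ω i)
      (Real.toNNReal (2 * (σ ^ 2 * (x i * x i)))) P := by
    intro i
    convert (hasSubgaussianMGF_of_lintegral_exp_sq_le (hmeas i) (hmean i) hσ
      (hsubg i)).const_mul (x i) using 1
    ext
    rw [Real.coe_toNNReal _ (mul_nonneg zero_le_two
      (mul_nonneg (sq_nonneg σ) (mul_self_nonneg _)))]
    change _ = x i ^ 2 * (2 * (Real.toNNReal (σ ^ 2) : ℝ))
    rw [Real.coe_toNNReal _ (sq_nonneg σ)]
    ring
  have hsum := HasSubgaussianMGF.sum_of_iIndepFun (s := Finset.univ) hind fun i _ => hi i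
  have hdot : ∀ ω, ξ ω ⬝ᵥ x = ∑ i, x i * ξ ω i := fun ω =>
    Finset.sum_congr rfl fun i _ => mul_comm _ _
  have hint : Integrable (fun ω => Real.exp (ξ ω ⬝ᵥ x)) P := by
    simpa [hdot] using hsum.integrable_exp_mul 1
  have hle : ∫ ω, Real.exp (ξ ω ⬝ᵥ x) ∂P ≤ Real.exp (σ ^ 2 * (x ⬝ᵥ x)) := by
    have h := hsum.mgf_le 1
    simp only [mgf, one_mul, ← hdot] at h
    refine h.trans_eq ?_
    rw [NNReal.coe_sum, Finset.sum_congr rfl fun i _ => Real.coe_toNNReal _ (mul_nonneg zero_le_two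
      (mul_nonneg (sq_nonneg σ) (mul_self_nonneg (x i)))), ← Finset.mul_sum, ← Finset.mul_sum]
    congr 1
    simp only [dotProduct]
    ring
  simp only [Real.exp_sub]
  rw [← ofReal_integral_eq_lintegral_ofReal (hint.div_const _)
    (ae_of_all _ fun ω => by positivity), integral_div]
  rw [ENNReal.ofReal_le_one, div_le_one (Real.exp_pos _)]
  exact hle

/-! ### The Gibbs variational inequality along a random walk -/

/-- The Gibbs variational inequality. The subprobability `w` may live on a larger index set than
`ρ`; the two are compared through the injection `e`. -/
theorem sum_mul_log_sub_le_log_sum {I J : Type*} [Fintype I] [Fintype J] {e : J → I}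
    (he : Function.Injective e) {w G : I → ℝ} (hw : ∀ i, 0 < w i) (hG : ∀ i, 0 < G i)
    {ρ : J → ℝ} (hρ : ∀ j, 0 ≤ ρ j) (hρ1 : ∑ j, ρ j = 1) :
    ∑ j, ρ j * Real.log (G (e j)) - ∑ j, ρ j * Real.log (ρ j / w (e j))
      ≤ Real.log (∑ i, w i * G i) := by
  classical
  set S := ∑ i, w i * G i with hS
  have hJ : Nonempty J := by
    by_contra h
    rw [not_nonempty_iff] at h
    simp at hρ1
  have hSpos : 0 < S :=
    Finset.sum_pos (fun i _ => mul_pos (hw i) (hG i)) ⟨e hJ.some, Finset.mem_univ _⟩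
  have hterm : ∀ j, ρ j * Real.log (G (e j)) - ρ j * Real.log (ρ j / w (e j))
      ≤ ρ j * Real.log S + (w (e j) * G (e j) / S - ρ j) := by
    intro j
    have hwj := hw (e j)
    have hGj := hG (e j)
    rcases (hρ j).eq_or_lt with h0 | hpos
    · rw [← h0]; simp; positivity
    · have h := Real.log_le_sub_one_of_pos (x := w (e j) * G (e j) / (ρ j * S)) (by positivity)
      rw [Real.log_div (by positivity) (by positivity), Real.log_mul hwj.ne' hGj.ne',
        Real.log_mul hpos.ne' hSpos.ne'] at h
      rw [Real.log_div hpos.ne' hwj.ne']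
      have h2 := mul_le_mul_of_nonneg_left h hpos.le
      have h3 : ρ j * (w (e j) * G (e j) / (ρ j * S) - 1) = w (e j) * G (e j) / S - ρ j := by
        field_simp
      rw [h3] at h2
      linarith
  have hsub : ∑ j, w (e j) * G (e j) ≤ S := by
    rw [hS, ← Finset.sum_image (s := Finset.univ) (g := e) (f := fun i => w i * G i)
      fun a _ b _ h => he h]
    exact Finset.sum_le_sum_of_subset_of_nonneg (Finset.subset_univ _)
      fun i _ _ => (mul_pos (hw i) (hG i)).le
  calc _ = ∑ j, (ρ j * Real.log (G (e j)) - ρ j * Real.log (ρ j / w (e j))) := by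
        rw [Finset.sum_sub_distrib]
    _ ≤ ∑ j, (ρ j * Real.log S + (w (e j) * G (e j) / S - ρ j)) :=
        Finset.sum_le_sum fun j _ => hterm j
    _ = Real.log S + ((∑ j, w (e j) * G (e j)) / S - 1) := by
        rw [Finset.sum_add_distrib, ← Finset.sum_mul, hρ1, one_mul, Finset.sum_sub_distrib, hρ1,
          Finset.sum_div]
    _ ≤ Real.log S := by
        have := (div_le_one hSpos).2 hsub
        linarith

/-- `walkPartition c w y ξ k x` is the sum of `exp (⟨ξ, z⟩ - c |z|²)` over the endpoints `z` of all
`k`-step walks from `x` with steps `y i`, each walk weighted by the product of the weights `w i` of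
its steps. -/
noncomputable def walkPartition {n : ℕ} {I : Type*} [Fintype I] (c : ℝ) (w : I → ℝ)
    (y : I → Fin n → ℝ) (ξ : Fin n → ℝ) : ℕ → (Fin n → ℝ) → ℝ
  | 0, x => Real.exp (ξ ⬝ᵥ x - c * (x ⬝ᵥ x))
  | k + 1, x => ∑ i, w i * walkPartition c w y ξ k (x + y i)

theorem walkPartition_pos {n : ℕ} {I : Type*} [Fintype I] [Nonempty I] {c : ℝ} {w : I → ℝ}
    (hw : ∀ i, 0 < w i) (y : I → Fin n → ℝ) (ξ : Fin n → ℝ) (k : ℕ) (x : Fin n → ℝ) :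
    0 < walkPartition c w y ξ k x := by
  induction k generalizing x with
  | zero => exact Real.exp_pos _
  | succ k ih =>
    exact Finset.sum_pos (fun i _ => mul_pos (hw i) (ih _)) Finset.univ_nonempty

theorem measurable_walkPartition {Ω : Type*} [MeasurableSpace Ω] {n : ℕ} {I : Type*} [Fintype I]
    (c : ℝ) (w : I → ℝ) (y : I → Fin n → ℝ) {ξ : Ω → Fin n → ℝ}
    (hmeas : ∀ i, Measurable fun ω => ξ ω i) (k : ℕ) (x : Fin n → ℝ) :
    Measurable fun ω => walkPartition c w y (ξ ω) k x := by
  induction k generalizing x with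
  | zero =>
    simp only [walkPartition, dotProduct]
    fun_prop
  | succ k ih =>
    simp only [walkPartition]
    exact Finset.measurable_fun_sum _ fun i _ => (ih _).const_mul _

theorem lintegral_walkPartition_le_one {Ω : Type*} [MeasurableSpace Ω] {P : Measure Ω} {n : ℕ}
    {I : Type*} [Fintype I] {c : ℝ} {w : I → ℝ} (hw : ∀ i, 0 ≤ w i) (hw1 : ∑ i, w i ≤ 1)
    (y : I → Fin n → ℝ) {ξ : Ω → Fin n → ℝ} (hmeas : ∀ i, Measurable fun ω => ξ ω i)
    (hξ : ∀ x, ∫⁻ ω, ENNReal.ofReal (Real.exp (ξ ω ⬝ᵥ x - c * (x ⬝ᵥ x))) ∂P ≤ 1)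
    (k : ℕ) (x : Fin n → ℝ) :
    ∫⁻ ω, ENNReal.ofReal (walkPartition c w y (ξ ω) k x) ∂P ≤ 1 := by
  induction k generalizing x with
  | zero => exact hξ x
  | succ k ih =>
    calc _ ≤ ∫⁻ ω, ∑ i, ENNReal.ofReal (w i) *
          ENNReal.ofReal (walkPartition c w y (ξ ω) k (x + y i)) ∂P := by
          refine lintegral_mono fun ω => ?_
          simp only [walkPartition, ← ENNReal.ofReal_mul (hw _)]
          exact Finset.le_sum_of_subadditive _ ENNReal.ofReal_zero.le
            (fun _ _ => ENNReal.ofReal_add_le) _ _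
      _ = ∑ i, ENNReal.ofReal (w i) *
          ∫⁻ ω, ENNReal.ofReal (walkPartition c w y (ξ ω) k (x + y i)) ∂P := by
          have hm := fun i => (measurable_walkPartition c w y hmeas k (x + y i)).ennreal_ofReal
          rw [lintegral_finsetSum _ fun i _ => (hm i).const_mul _]
          exact Finset.sum_congr rfl fun i _ => lintegral_const_mul _ (hm i)
      _ ≤ ∑ i, ENNReal.ofReal (w i) := by
          refine Finset.sum_le_sum fun i _ => ?_
          exact (mul_le_mul_right (ih _) _).trans_eq (mul_one _)
      _ = ENNReal.ofReal (∑ i, w i) := (ENNReal.ofReal_sum_of_nonneg fun i _ => hw i).symm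
      _ ≤ 1 := ENNReal.ofReal_le_one.2 hw1

/-- Lower bound of the partition function by a walk with step law `ρ`: each step costs its relative
entropy with respect to `w` and `c` times its second moment. -/
theorem le_log_walkPartition {n : ℕ} {I J : Type*} [Fintype I] [Nonempty I] [Fintype J]
    {e : J → I} (he : Function.Injective e) {c : ℝ} (hc : 0 ≤ c) {w : I → ℝ} (hw : ∀ i, 0 < w i)
    (y : I → Fin n → ℝ) (ξ : Fin n → ℝ) {ρ : J → ℝ} (hρ : ∀ j, 0 ≤ ρ j) (hρ1 : ∑ j, ρ j = 1)
    (k : ℕ) (x : Fin n → ℝ) :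
    ξ ⬝ᵥ (x + (k : ℝ) • ∑ j, ρ j • y (e j))
        - c * ((x + (k : ℝ) • ∑ j, ρ j • y (e j)) ⬝ᵥ (x + (k : ℝ) • ∑ j, ρ j • y (e j)))
        - k * (c * ∑ j, ρ j * (y (e j) ⬝ᵥ y (e j)))
        - k * ∑ j, ρ j * Real.log (ρ j / w (e j))
      ≤ Real.log (walkPartition c w y ξ k x) := by
  set m := ∑ j, ρ j • y (e j) with hm
  set V := ∑ j, ρ j * (y (e j) ⬝ᵥ y (e j)) with hV
  set K := ∑ j, ρ j * Real.log (ρ j / w (e j)) with hK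
  induction k generalizing x with
  | zero => simp [walkPartition]
  | succ k ih =>
    have h1 := sum_mul_log_sub_le_log_sum he hw
      (G := fun i => walkPartition c w y ξ k (x + y i))
      (fun i => walkPartition_pos hw y ξ k _) hρ hρ1
    have h2 := Finset.sum_le_sum fun j (_ : j ∈ Finset.univ) =>
      mul_le_mul_of_nonneg_left (ih (x + y (e j))) (hρ j)
    set z := x + (k : ℝ) • m with hz
    have hlin : ∀ v : Fin n → ℝ, ∑ j, ρ j * (v ⬝ᵥ y (e j)) = v ⬝ᵥ m := by
      intro v
      rw [hm, dotProduct_sum]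
      exact Finset.sum_congr rfl fun j _ => by rw [dotProduct_smul, smul_eq_mul]
    have hsq : ∀ a b : Fin n → ℝ, (a + b) ⬝ᵥ (a + b) = a ⬝ᵥ a + 2 * (a ⬝ᵥ b) + b ⬝ᵥ b := by
      intro a b
      rw [dotProduct_add, add_dotProduct, add_dotProduct, dotProduct_comm b a]
      ring
    -- Averaging the quadratic over one step moves its argument by the mean step and costs at most
    -- the second moment of the step.
    have havg : ∑ j, ρ j * (ξ ⬝ᵥ (x + y (e j) + (k : ℝ) • m)
        - c * ((x + y (e j) + (k : ℝ) • m) ⬝ᵥ (x + y (e j) + (k : ℝ) • m)) - k * (c * V) - k * K)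
        = ξ ⬝ᵥ z + ξ ⬝ᵥ m - c * (z ⬝ᵥ z + 2 * (z ⬝ᵥ m) + V) - k * (c * V) - k * K := by
      have hexp : ∀ j, ρ j * (ξ ⬝ᵥ (x + y (e j) + (k : ℝ) • m)
          - c * ((x + y (e j) + (k : ℝ) • m) ⬝ᵥ (x + y (e j) + (k : ℝ) • m))
            - k * (c * V) - k * K)
          = ρ j * (ξ ⬝ᵥ z - c * (z ⬝ᵥ z) - k * (c * V) - k * K) + ρ j * (ξ ⬝ᵥ y (e j))
            - 2 * c * (ρ j * (z ⬝ᵥ y (e j))) - c * (ρ j * (y (e j) ⬝ᵥ y (e j))) := by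
        intro j
        have : x + y (e j) + (k : ℝ) • m = z + y (e j) := by rw [hz]; abel
        rw [this, dotProduct_add ξ z, hsq]
        ring
      simp only [hexp]
      rw [Finset.sum_sub_distrib, Finset.sum_sub_distrib, Finset.sum_add_distrib,
        ← Finset.sum_mul, hρ1, ← Finset.mul_sum, ← Finset.mul_sum, hlin, hlin, ← hV]
      ring
    rw [havg] at h2
    have hstep : x + ((k + 1 : ℕ) : ℝ) • m = z + m := by
      rw [hz]; push_cast; rw [add_smul, one_smul]; abel
    have hmm : 0 ≤ c * (m ⬝ᵥ m) :=
      mul_nonneg hc (Finset.sum_nonneg fun i _ => mul_self_nonneg _)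
    rw [hstep, dotProduct_add ξ z, hsq, walkPartition]
    push_cast
    linarith

/-- Markov's inequality at the levels `2 ^ (k + 1) / δ`, whose failure probabilities sum to `δ`,
holds for all `k` at once; it is applied to the partition functions of the walks of length `k`. -/
theorem ofReal_one_sub_le_measure_forall_le {Ω : Type*} [MeasurableSpace Ω] (P : Measure Ω)
    [IsProbabilityMeasure P] {F : ℕ → Ω → ℝ} (hF : ∀ k, Measurable (F k))
    (hF1 : ∀ k, ∫⁻ ω, ENNReal.ofReal (F k ω) ∂P ≤ 1) {δ : ℝ} (hδ : 0 < δ) :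
    ENNReal.ofReal (1 - δ) ≤ P {ω | ∀ k, F k ω ≤ 2 ^ (k + 1) / δ} := by
  set B : ℕ → Set Ω := fun k => {ω | 2 ^ (k + 1) / δ < F k ω} with hB
  have hBm : ∀ k, MeasurableSet (B k) := fun k => measurableSet_lt measurable_const (hF k)
  have hBk : ∀ k, P (B k) ≤ ENNReal.ofReal (δ / 2 / 2 ^ k) := by
    intro k
    have hε : 0 < (2 : ℝ) ^ (k + 1) / δ := by positivity
    have h := mul_meas_ge_le_lintegral (μ := P) (hF k).ennreal_ofReal
      (ENNReal.ofReal (2 ^ (k + 1) / δ))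
    have h2 : P (B k) ≤ P {ω | ENNReal.ofReal (2 ^ (k + 1) / δ) ≤ ENNReal.ofReal (F k ω)} :=
      measure_mono fun ω hω => ENNReal.ofReal_le_ofReal (le_of_lt hω)
    have h3 : ENNReal.ofReal (2 ^ (k + 1) / δ) * P (B k) ≤ 1 :=
      (mul_le_mul_right h2 _).trans (h.trans (hF1 k))
    have h4 : δ / 2 / 2 ^ k = ((2 : ℝ) ^ (k + 1) / δ)⁻¹ := by
      rw [pow_succ]; field_simp
    rw [h4, ENNReal.ofReal_inv_of_pos hε, ENNReal.le_inv_iff_mul_le, mul_comm]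
    exact h3
  have hU : P (⋃ k, B k) ≤ ENNReal.ofReal δ := by
    have hs : HasSum (fun k : ℕ => δ / 2 / 2 ^ k) δ := hasSum_geometric_two' δ
    calc P (⋃ k, B k) ≤ ∑' k, P (B k) := measure_iUnion_le _
      _ ≤ ∑' k, ENNReal.ofReal (δ / 2 / 2 ^ k) := ENNReal.tsum_le_tsum hBk
      _ = ENNReal.ofReal δ := by
        rw [← ENNReal.ofReal_tsum_of_nonneg (fun k => by positivity) hs.summable, hs.tsum_eq]
  have hset : {ω | ∀ k, F k ω ≤ 2 ^ (k + 1) / δ} = (⋃ k, B k)ᶜ := by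
    ext ω; simp [hB]
  rw [hset, prob_compl_eq_one_sub (MeasurableSet.iUnion hBm), ENNReal.ofReal_sub _ hδ.le,
    ENNReal.ofReal_one]
  exact tsub_le_tsub_left hU _

/-! ### Dyadic levels of the ranks -/

/-- The integer part of `log₂ (p / (j + 1))`. The rank `j` (counted from `0`) belongs to the dyadic
block of ranks with this level, and `rankLevel j + 1` is comparable to `log (2p / (j + 1))`. -/
def rankLevel {p : ℕ} (j : Fin p) : ℕ := Nat.log 2 (p / (j + 1))

theorem two_pow_rankLevel_mul_le {p : ℕ} (j : Fin p) : 2 ^ rankLevel j * ((j : ℕ) + 1) ≤ p := by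
  have hj : (j : ℕ) + 1 ≤ p := j.2
  have h : p / ((j : ℕ) + 1) ≠ 0 := (Nat.div_pos hj (Nat.succ_pos _)).ne'
  exact (Nat.le_div_iff_mul_le (Nat.succ_pos _)).1 (Nat.pow_log_le_self 2 h)

theorem lt_two_pow_rankLevel_succ_mul {p : ℕ} (j : Fin p) :
    p < 2 ^ (rankLevel j + 1) * ((j : ℕ) + 1) :=
  (Nat.div_lt_iff_lt_mul (Nat.succ_pos _)).1 (Nat.lt_pow_succ_log_self one_lt_two _)

theorem rankLevel_lt {p : ℕ} (j : Fin p) : rankLevel j < p + 1 :=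
  Nat.lt_succ_of_le ((Nat.log_le_self 2 _).trans (Nat.div_le_self _ _))

theorem rankLevel_le_succ {p : ℕ} {i j : Fin p} (h : (j : ℕ) + 1 ≤ 2 * ((i : ℕ) + 1)) :
    rankLevel i ≤ rankLevel j + 1 := by
  have h1 := two_pow_rankLevel_mul_le i
  have h2 := lt_two_pow_rankLevel_succ_mul j
  by_contra hlt
  have h3 : 2 ^ (rankLevel j + 2) ≤ 2 ^ rankLevel i := Nat.pow_le_pow_right two_pos (by omega)
  have h4 : 2 ^ (rankLevel j + 2) = 2 * 2 ^ (rankLevel j + 1) := by ring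
  rw [h4] at h3
  have h5 := Nat.mul_le_mul_right ((i : ℕ) + 1) h3
  have h6 := Nat.mul_le_mul_left (2 ^ (rankLevel j + 1)) h
  linarith

theorem succ_rankLevel_mul_log_two_le {p : ℕ} (j : Fin p) :
    ((rankLevel j : ℝ) + 1) * Real.log 2 ≤ Real.log (2 * (p : ℝ) / ((j : ℝ) + 1)) := by
  have h : (2 : ℝ) ^ rankLevel j * ((j : ℝ) + 1) ≤ p := by
    exact_mod_cast two_pow_rankLevel_mul_le j
  have h2 : (2 : ℝ) ^ (rankLevel j + 1) ≤ 2 * (p : ℝ) / ((j : ℝ) + 1) := by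
    rw [le_div_iff₀ (by positivity), pow_succ]
    linarith
  have h3 := Real.log_le_log (by positivity) h2
  rwa [Real.log_pow, Nat.cast_add, Nat.cast_one] at h3

/-- For a non-increasing `a`, the normalised terms `a j / √(rankLevel j + 1)` decay like
`1 / (j + 1)` relative to their sum: the ranks between `j / 2` and `j` have nearly the level of `j`. -/
theorem succ_mul_div_sqrt_rankLevel_le {p : ℕ} {a : Fin p → ℝ} (ha : Antitone a)
    (ha0 : ∀ i, 0 ≤ a i) (j : Fin p) :
    ((j : ℝ) + 1) * (a j / √((rankLevel j : ℝ) + 1))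
      ≤ 4 * ∑ i, a i / √((rankLevel i : ℝ) + 1) := by
  set h : Fin p := ⟨(j : ℕ) / 2, (Nat.div_le_self _ _).trans_lt j.2⟩ with hh
  have hterm : ∀ i ∈ Finset.Icc h j,
      a j / √((rankLevel j : ℝ) + 1) / 2 ≤ a i / √((rankLevel i : ℝ) + 1) := by
    intro i hi
    rw [Finset.mem_Icc] at hi
    have hi1 : (j : ℕ) / 2 ≤ (i : ℕ) := hi.1
    have hl : rankLevel i ≤ rankLevel j + 1 := rankLevel_le_succ (by omega)
    have hl' : (rankLevel i : ℝ) ≤ rankLevel j + 1 := by exact_mod_cast hl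
    have hs : √((rankLevel i : ℝ) + 1) ≤ √((rankLevel j : ℝ) + 1) * 2 := by
      rw [Real.sqrt_le_left (by positivity), mul_pow, Real.sq_sqrt (by positivity)]
      have : (0 : ℝ) ≤ rankLevel j := Nat.cast_nonneg _
      linarith
    rw [div_div]
    exact div_le_div₀ (ha0 i) (ha hi.2) (by positivity) hs
  have hcard : ((j : ℝ) + 1) / 2 ≤ ((Finset.Icc h j).card : ℝ) := by
    have : (j : ℕ) + 1 ≤ 2 * (Finset.Icc h j).card := by
      rw [Fin.card_Icc, hh]
      change (j : ℕ) + 1 ≤ 2 * ((j : ℕ) + 1 - (j : ℕ) / 2)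
      omega
    have : ((j : ℝ) + 1) ≤ 2 * ((Finset.Icc h j).card : ℝ) := by exact_mod_cast this
    linarith
  have hnn : 0 ≤ a j / √((rankLevel j : ℝ) + 1) := div_nonneg (ha0 j) (Real.sqrt_nonneg _)
  have h1 := Finset.card_nsmul_le_sum _ _ _ hterm
  rw [nsmul_eq_mul] at h1
  have h2 : ∑ i ∈ Finset.Icc h j, a i / √((rankLevel i : ℝ) + 1)
      ≤ ∑ i, a i / √((rankLevel i : ℝ) + 1) :=
    Finset.sum_le_sum_of_subset_of_nonneg (Finset.subset_univ _)
      fun i _ _ => div_nonneg (ha0 i) (Real.sqrt_nonneg _)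
  nlinarith

/-! ### The prior walk -/

/-- Prior law of one step: no step with weight `1/2`, and otherwise a uniform column, a dyadic level
`l` with weight `2 ^ (-(l + 1))`, and a uniform sign. -/
noncomputable def stepWeight {p : ℕ} : Option (Fin p × Fin (p + 1) × Bool) → ℝ
  | none => 1 / 2
  | some (_, l, _) => (1 / 2) ^ ((l : ℕ) + 1) / (4 * p)

/-- The step attached to a column `i`, a level `l` and a sign is the `i`-th column of `X`,
multiplied by `±τ √(l + 1)`. -/
noncomputable def stepVector {n p : ℕ} (X : Matrix (Fin n) (Fin p) ℝ) (τ : ℝ) :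
    Option (Fin p × Fin (p + 1) × Bool) → Fin n → ℝ
  | none => 0
  | some (i, l, b) => ((if b then 1 else -1) * (τ * √((l : ℝ) + 1))) • fun r => X r i

theorem stepWeight_pos {p : ℕ} (s : Option (Fin p × Fin (p + 1) × Bool)) : 0 < stepWeight s := by
  rcases s with _ | ⟨i, l, b⟩
  · norm_num [stepWeight]
  · have : (0 : ℝ) < p := by exact_mod_cast i.pos
    simp only [stepWeight]
    positivity

theorem sum_stepWeight_le_one (p : ℕ) :
    ∑ s : Option (Fin p × Fin (p + 1) × Bool), stepWeight s ≤ 1 := by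
  have hgeom : ∑ l : Fin (p + 1), (1 / 2 : ℝ) ^ ((l : ℕ) + 1) ≤ 1 := by
    rw [Fin.sum_univ_eq_sum_range (fun l => (1 / 2 : ℝ) ^ (l + 1))]
    simp only [pow_succ]
    rw [← Finset.sum_mul]
    have := sum_geometric_two_le (p + 1)
    linarith
  rw [Fintype.sum_option, Fintype.sum_prod_type]
  simp only [stepWeight, Fintype.sum_prod_type, Finset.sum_const, Finset.card_univ, nsmul_eq_mul,
    Fintype.card_bool, Fintype.card_fin, Nat.cast_ofNat]
  rw [← Finset.mul_sum, ← Finset.sum_div]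
  set S := ∑ l : Fin (p + 1), (1 / 2 : ℝ) ^ ((l : ℕ) + 1)
  rcases Nat.eq_zero_or_pos p with h0 | hp
  · subst h0; norm_num
  · have hp' : (0 : ℝ) < p := by exact_mod_cast hp
    have : (p : ℝ) * (2 * (S / (4 * p))) = S / 2 := by field_simp; ring
    linarith

/-! ### The deterministic bound -/

/-- A Markov bound on all the partition functions controls `⟨ξ, X u⟩` for every `u`, by comparison
with the walk with mean `X u` whose steps pick the column of rank `j` at the level of that rank. -/
theorem dotProduct_mulVec_le_of_walkPartition_le {n p : ℕ} {X : Matrix (Fin n) (Fin p) ℝ}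
    (hX : ∀ i, (fun r => X r i) ⬝ᵥ (fun r => X r i) ≤ n) {σ δ τ : ℝ} (hδ : 0 < δ) (hτ : 0 < τ)
    {ξ : Fin n → ℝ}
    (hξ : ∀ k, walkPartition (σ ^ 2) stepWeight (stepVector X τ) ξ k 0 ≤ 2 ^ (k + 1) / δ)
    (u : Fin p → ℝ) (π : Equiv.Perm (Fin p)) (hπ : Antitone fun j => |u (π j)|) :
    ξ ⬝ᵥ (X *ᵥ u) ≤ σ ^ 2 * ((X *ᵥ u) ⬝ᵥ (X *ᵥ u))
      + (σ ^ 2 * n * τ + 7 * Real.log 2 / τ) * (∑ j, |u (π j)| * √((rankLevel j : ℝ) + 1))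
      + 3 * Real.log 2 + Real.log (1 / δ) := by
  set D : Fin p → ℝ := fun j => (rankLevel j : ℝ) + 1 with hD
  have hD1 : ∀ j, 1 ≤ D j := fun j => by simp [hD]
  have hD0 : ∀ j, 0 < D j := fun j => zero_lt_one.trans_le (hD1 j)
  have hsD : ∀ j, 0 < √(D j) := fun j => Real.sqrt_pos.2 (hD0 j)
  have hlog2 : 0 < Real.log 2 := Real.log_pos one_lt_two
  set A := ∑ j, |u (π j)| * √(D j) with hA
  -- `m j` is the expected number of steps along the column of rank `j`, `κ` the expected number of
  -- nonzero steps, and the walk has `k` steps.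
  set m : Fin p → ℝ := fun j => |u (π j)| / √(D j) / τ with hm
  have hm0 : ∀ j, 0 ≤ m j := fun j => by positivity
  set κ := ∑ j, m j with hκ
  have hκ0 : 0 ≤ κ := Finset.sum_nonneg fun j _ => hm0 j
  -- The successor of the floor keeps `k` positive even when `u = 0`.
  set k := ⌊κ⌋₊ + 1 with hk
  have hk1 : (k : ℝ) ≤ κ + 1 := by
    rw [hk]; push_cast; linarith [Nat.floor_le hκ0]
  have hk2 : κ ≤ k := by rw [hk]; push_cast; exact (Nat.lt_floor_add_one κ).le
  have hk0 : (0 : ℝ) < k := by rw [hk]; positivity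
  have hmD : ∑ j, m j * D j = A / τ := by
    rw [hA, Finset.sum_div]
    refine Finset.sum_congr rfl fun j _ => ?_
    have h := Real.mul_self_sqrt (hD0 j).le
    have h' := hsD j
    simp only [hm]
    rw [← h, Real.sqrt_mul_self (Real.sqrt_nonneg _)]
    field_simp
  have hκle : κ ≤ A / τ := by
    rw [← hmD]
    exact Finset.sum_le_sum fun j _ => le_mul_of_one_le_right (hm0 j) (hD1 j)
  have hmj : ∀ j : Fin p, ((j : ℝ) + 1) * m j ≤ 4 * k := by
    intro j
    have h := succ_mul_div_sqrt_rankLevel_le hπ (fun _ => abs_nonneg _) j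
    have h2 : ((j : ℝ) + 1) * m j ≤ 4 * κ := by
      rw [hκ]
      simp only [hm, ← Finset.sum_div, mul_div_assoc']
      rw [mul_div_assoc'] at h
      exact div_le_div_of_nonneg_right h hτ.le
    linarith
  set e : Option (Fin p) → Option (Fin p × Fin (p + 1) × Bool) :=
    Option.map fun j => (π j, ⟨rankLevel j, rankLevel_lt j⟩, decide (0 ≤ u (π j))) with he
  have heinj : Function.Injective e := by
    refine Option.map_injective fun i j hij => ?_
    exact π.injective (Prod.ext_iff.1 hij).1
  set ρ : Option (Fin p) → ℝ := fun s => s.elim (1 - κ / k) fun j => m j / k with hρ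
  have hρn : 0 ≤ 1 - κ / k := sub_nonneg.2 ((div_le_one hk0).2 hk2)
  have hρ0 : ∀ s, 0 ≤ ρ s := by
    rintro (_ | j)
    · exact hρn
    · exact div_nonneg (hm0 j) hk0.le
  have hρ1 : ∑ s, ρ s = 1 := by
    simp only [Fintype.sum_option, hρ, Option.elim]
    rw [← Finset.sum_div, ← hκ]; ring
  have hcoef : ∀ j, m j * ((if decide (0 ≤ u (π j)) then 1 else -1) * (τ * √(D j))) = u (π j) := by
    intro j
    have h1 : m j * (τ * √(D j)) = |u (π j)| := by
      have := hsD j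
      simp only [hm]
      field_simp
    rw [mul_left_comm, h1]
    rcases le_or_gt 0 (u (π j)) with h | h
    · simp [h, abs_of_nonneg h]
    · simp [h.not_ge, abs_of_neg h]
  have hsq : ∀ j, stepVector X τ (e (some j)) ⬝ᵥ stepVector X τ (e (some j)) ≤ τ ^ 2 * D j * n := by
    intro j
    simp only [he, Option.map_some, stepVector, smul_dotProduct, dotProduct_smul, smul_eq_mul]
    rw [← mul_assoc]
    have h1 : ((if decide (0 ≤ u (π j)) = true then (1 : ℝ) else -1) * (τ * √(D j))) *
        ((if decide (0 ≤ u (π j)) = true then (1 : ℝ) else -1) * (τ * √(D j))) = τ ^ 2 * D j := by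
      have h2 := Real.mul_self_sqrt (hD0 j).le
      split_ifs <;> linear_combination τ ^ 2 * h2
    rw [h1]
    exact mul_le_mul_of_nonneg_left (hX _) (mul_nonneg (sq_nonneg τ) (hD0 j).le)
  have hmean : (k : ℝ) • ∑ s, ρ s • stepVector X τ (e s) = X *ᵥ u := by
    ext r
    rw [Matrix.mulVec, dotProduct, ← Equiv.sum_comp π]
    simp only [Fintype.sum_option, hρ, Option.elim, he, Option.map_some, Option.map_none,
      stepVector, smul_zero, zero_add, Pi.smul_apply, Finset.sum_apply, smul_eq_mul, Finset.mul_sum]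
    refine Finset.sum_congr rfl fun j _ => ?_
    have h1 : ∀ a b : ℝ, (k : ℝ) * (m j / k * (a * b)) = b * (m j * a) := by
      intro a b; field_simp
    rw [h1]
    exact congrArg _ (hcoef j)
  have hsecond : k * (σ ^ 2 * ∑ s, ρ s * (stepVector X τ (e s) ⬝ᵥ stepVector X τ (e s)))
      ≤ σ ^ 2 * n * τ * A := by
    have h1 : ∑ s, ρ s * (stepVector X τ (e s) ⬝ᵥ stepVector X τ (e s))
        ≤ ∑ j, τ ^ 2 * n / k * (m j * D j) := by
      rw [Fintype.sum_option]
      have h0 : stepVector X τ (e none) = 0 := rfl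
      rw [h0, dotProduct_zero, mul_zero, zero_add]
      refine Finset.sum_le_sum fun j _ => ?_
      refine (mul_le_mul_of_nonneg_left (hsq j) (hρ0 _)).trans_eq ?_
      simp only [hρ, Option.elim]
      ring
    rw [← Finset.mul_sum, hmD] at h1
    calc _ ≤ k * (σ ^ 2 * (τ ^ 2 * n / k * (A / τ))) := by gcongr
      _ = _ := by field_simp
  have hentropy : k * ∑ s, ρ s * Real.log (ρ s / stepWeight (e s))
      ≤ Real.log 2 + 6 * Real.log 2 * (A / τ) := by
    rw [Fintype.sum_option, mul_add, ← hmD, Finset.mul_sum, Finset.mul_sum]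
    refine add_le_add ?_ (Finset.sum_le_sum fun j _ => ?_)
    · change (k : ℝ) * ((1 - κ / k) * Real.log ((1 - κ / k) / (1 / 2))) ≤ _
      rcases hρn.eq_or_lt with h | h
      · rw [← h]; simpa using hlog2.le
      · have h1 : Real.log ((1 - κ / k) / (1 / 2)) ≤ Real.log 2 := by
          refine Real.log_le_log (by positivity) ?_
          have : 0 ≤ κ / k := by positivity
          linarith
        have h2 : (k : ℝ) * (1 - κ / k) ≤ 1 := by
          rw [mul_sub, mul_div_cancel₀ _ hk0.ne']; linarith
        calc _ = (k : ℝ) * (1 - κ / k) * Real.log ((1 - κ / k) / (1 / 2)) := by ring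
          _ ≤ (k : ℝ) * (1 - κ / k) * Real.log 2 := by gcongr
          _ ≤ 1 * Real.log 2 := by gcongr
          _ = _ := one_mul _
    · change (k : ℝ) * (m j / k * Real.log (m j / k / ((1 / 2) ^ (rankLevel j + 1) / (4 * p)))) ≤ _
      rcases (hm0 j).eq_or_lt with h | h
      · rw [← h]; simp
      · have hp : (0 : ℝ) < p := by exact_mod_cast j.pos
        have hjp : (p : ℝ) ≤ 2 ^ (rankLevel j + 1) * ((j : ℝ) + 1) := by
          exact_mod_cast (lt_two_pow_rankLevel_succ_mul j).le
        have h1 : m j / k / ((1 / 2) ^ (rankLevel j + 1) / (4 * p))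
            ≤ 2 ^ (4 + 2 * (rankLevel j + 1)) := by
          have h2 : m j / k / ((1 / 2) ^ (rankLevel j + 1) / (4 * p))
              = 4 * 2 ^ (rankLevel j + 1) * (p * m j) / k := by
            rw [one_div, inv_pow]; field_simp
          rw [h2, div_le_iff₀ hk0]
          calc 4 * 2 ^ (rankLevel j + 1) * (p * m j)
              ≤ 4 * 2 ^ (rankLevel j + 1) * (2 ^ (rankLevel j + 1) * ((j : ℝ) + 1) * m j) := by
                gcongr
            _ = 4 * 2 ^ (rankLevel j + 1) * 2 ^ (rankLevel j + 1) * (((j : ℝ) + 1) * m j) := by ring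
            _ ≤ 4 * 2 ^ (rankLevel j + 1) * 2 ^ (rankLevel j + 1) * (4 * k) :=
                mul_le_mul_of_nonneg_left (hmj j) (by positivity)
            _ = _ := by ring
        have h3 := Real.log_le_log (by positivity) h1
        rw [Real.log_pow] at h3
        push_cast at h3
        have h4 : (4 + 2 * ((rankLevel j : ℝ) + 1)) * Real.log 2 ≤ 6 * D j * Real.log 2 :=
          mul_le_mul_of_nonneg_right (by have := hD1 j; simp only [hD] at this ⊢; linarith) hlog2.le
        rw [← mul_assoc, mul_div_cancel₀ _ hk0.ne']
        calc _ ≤ m j * (6 * D j * Real.log 2) := mul_le_mul_of_nonneg_left (h3.trans h4) h.le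
          _ = _ := by ring
  have hwalk := le_log_walkPartition heinj (sq_nonneg σ) stepWeight_pos (stepVector X τ) ξ hρ0 hρ1
    k 0
  rw [zero_add, hmean] at hwalk
  have hmarkov : Real.log (walkPartition (σ ^ 2) stepWeight (stepVector X τ) ξ k 0)
      ≤ (k + 1) * Real.log 2 + Real.log (1 / δ) := by
    refine (Real.log_le_log (walkPartition_pos stepWeight_pos _ _ _ _) (hξ k)).trans_eq ?_
    rw [div_eq_mul_one_div, Real.log_mul (by positivity) (by positivity), Real.log_pow]
    push_cast; ring
  have hkl : ((k : ℝ) + 1) * Real.log 2 ≤ (A / τ + 2) * Real.log 2 :=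
    mul_le_mul_of_nonneg_right (by linarith) hlog2.le
  have hfin : (σ ^ 2 * n * τ + 7 * Real.log 2 / τ) * A
      = σ ^ 2 * n * τ * A + 7 * Real.log 2 * (A / τ) := by ring
  rw [hfin]
  linarith

/-! ### The uniform bound -/

theorem mainTheorem11
    {Ω : Type*} [MeasurableSpace Ω] (P : Measure Ω) [IsProbabilityMeasure P]
    (n p : ℕ) (δ₀ : ℝ) (hδ₀ : δ₀ ∈ Set.Ioo (0 : ℝ) 1)
    (ξ : Ω → Fin n → ℝ)
    (hmeas : ∀ i, Measurable fun ω => ξ ω i)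
    (hindep : iIndepFun (fun (i : Fin n) (ω : Ω) => ξ ω i) P)
    (hmean : ∀ i, ∫ ω, ξ ω i ∂P = 0)
    (σ : ℝ) (hσ : 0 < σ)
    (hsubg : ∀ i, ∫⁻ ω, ENNReal.ofReal (Real.exp (ξ ω i ^ 2 / σ ^ 2)) ∂P
      ≤ ENNReal.ofReal (Real.exp 1))
    (X : Matrix (Fin n) (Fin p) ℝ)
    (hX : ∀ j, empNorm (X *ᵥ Pi.single j (1 : ℝ)) ≤ 1) :
    ENNReal.ofReal (1 - δ₀) ≤
      P {ω | ∀ u : Fin p → ℝ,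
        (1 / (n : ℝ)) * (ξ ω ⬝ᵥ (X *ᵥ u)) ≤
          40 * σ * max
            (∑ j : Fin p, sharp u j *
              Real.sqrt (Real.log (2 * (p : ℝ) / ((j : ℝ) + 1)) / (n : ℝ)))
            (empNorm (X *ᵥ u) *
              ((Real.sqrt (Real.pi / 2) + Real.sqrt (2 * Real.log (1 / δ₀))) /
                Real.sqrt (n : ℝ)))} := by
  obtain ⟨hδ, hδ1⟩ := hδ₀
  -- This `τ` balances, up to constants, the second moments `σ² n τ` against the entropy `1 / τ`.
  set τ : ℝ := 2 / (σ * √n) with hτ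
  refine (ofReal_one_sub_le_measure_forall_le P
    (F := fun k ω => walkPartition (σ ^ 2) stepWeight (stepVector X τ) (ξ ω) k 0)
    (fun k => measurable_walkPartition _ _ _ hmeas k 0)
    (fun k => lintegral_walkPartition_le_one (fun s => (stepWeight_pos s).le)
      (sum_stepWeight_le_one p) _ hmeas
      (lintegral_exp_dotProduct_sub_le_one hmeas hindep hmean hσ hsubg) k 0) hδ).trans
    (measure_mono fun ω hω u => ?_)
  set v := X *ᵥ u with hv
  set L := Real.log (1 / δ₀) with hL
  have hL0 : 0 < L := Real.log_pos ((one_lt_div hδ).2 hδ1)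
  set G := empNorm v * ((√(Real.pi / 2) + √(2 * L)) / √n) with hG
  set H := ∑ j : Fin p, sharp u j * √(Real.log (2 * (p : ℝ) / ((j : ℝ) + 1)) / n) with hH
  have hG0 : 0 ≤ G := mul_nonneg (Real.sqrt_nonneg _) (by positivity)
  rcases eq_or_ne v 0 with h0 | hv0
  · rw [h0, dotProduct_zero, mul_zero]
    exact mul_nonneg (by positivity) (hG0.trans (le_max_right _ _))
  have hn : 0 < n := by
    rcases Nat.eq_zero_or_pos n with h | h
    · subst h; exact absurd (Subsingleton.elim v 0) hv0
    · exact h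
  have hn' : (0 : ℝ) < n := by exact_mod_cast hn
  have hsn : 0 < √(n : ℝ) := Real.sqrt_pos.2 hn'
  have hsnn : √(n : ℝ) * √n = n := Real.mul_self_sqrt hn'.le
  have hlog2 : 0 < Real.log 2 := Real.log_pos one_lt_two
  have hlog2l : (0.69 : ℝ) < Real.log 2 := by linarith [Real.log_two_gt_d9]
  have hlog2u : Real.log 2 < (0.7 : ℝ) := by linarith [Real.log_two_lt_d9]
  have hcol : ∀ i, (fun r => X r i) ⬝ᵥ (fun r => X r i) ≤ (n : ℝ) := by
    intro i
    have h := hX i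
    rw [Matrix.mulVec_single_one, empNorm] at h
    replace h := (Real.sqrt_le_iff.1 h).2
    rw [one_pow, one_div, inv_mul_le_iff₀ hn', mul_one] at h
    simpa [dotProduct, sq, Matrix.col] using h
  set N := v ⬝ᵥ v with hN
  have hN0 : 0 < N := by
    refine lt_of_le_of_ne (Finset.sum_nonneg fun i _ => mul_self_nonneg _) fun h => hv0 ?_
    exact dotProduct_self_eq_zero.1 h.symm
  set A := ∑ j, |u (Tuple.sort (fun i => -|u i|) j)| * √((rankLevel j : ℝ) + 1) with hA
  -- Here `0.8 ≤ √(log 2)` converts levels, which are logarithms to base `2`.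
  have hAH : 0.8 * A ≤ √n * H := by
    rw [hA, hH, Finset.mul_sum, Finset.mul_sum]
    refine Finset.sum_le_sum fun j _ => ?_
    change _ ≤ √n * (|u (Tuple.sort (fun i => -|u i|) j)| * _)
    have h1 : 0.8 * √((rankLevel j : ℝ) + 1)
        ≤ √n * √(Real.log (2 * (p : ℝ) / ((j : ℝ) + 1)) / n) := by
      rw [← Real.sqrt_mul hn'.le, mul_div_cancel₀ _ hn'.ne']
      refine Real.le_sqrt_of_sq_le ?_
      rw [mul_pow, Real.sq_sqrt (by positivity)]
      refine le_trans ?_ (succ_rankLevel_mul_log_two_le j)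
      have : (0 : ℝ) < (rankLevel j : ℝ) + 1 := by positivity
      nlinarith
    have h2 := mul_le_mul_of_nonneg_left h1 (abs_nonneg (u (Tuple.sort (fun i => -|u i|) j)))
    linarith
  set q := 3 * Real.log 2 + L with hq
  have hq0 : 0 < q := by positivity
  -- The scaling of `u` that balances `t σ² |v|²` against `q / t`.
  set t := √q / (σ * √N) with ht
  have hsN : 0 < √N := Real.sqrt_pos.2 hN0
  have ht0 : 0 < t := div_pos (Real.sqrt_pos.2 hq0) (mul_pos hσ hsN)
  have hmain := dotProduct_mulVec_le_of_walkPartition_le hcol hδ (by positivity : 0 < τ) hω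
    (t • u) (Tuple.sort fun i => -|u i|) (by
      intro i j hij
      simp only [Pi.smul_apply, smul_eq_mul, abs_mul]
      exact mul_le_mul_of_nonneg_left (sharp_antitone u hij) (abs_nonneg _))
  simp only [Pi.smul_apply, smul_eq_mul, abs_mul, abs_of_pos ht0, mul_assoc t, ← Finset.mul_sum,
    Matrix.mulVec_smul, dotProduct_smul, smul_dotProduct] at hmain
  rw [← hv, ← hN, ← hA, ← hL] at hmain
  have hcoef : σ ^ 2 * n * τ + 7 * Real.log 2 / τ = (2 + 7 / 2 * Real.log 2) * (σ * √n) := by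
    have h1 : σ ^ 2 * n * τ = 2 * (σ * √n) := by
      rw [hτ, mul_div_assoc', div_eq_iff (by positivity)]
      linear_combination (-2 * σ ^ 2) * hsnn
    have h2 : 7 * Real.log 2 / τ = 7 / 2 * Real.log 2 * (σ * √n) := by
      rw [hτ]; field_simp
    rw [h1, h2, ← add_mul]
  have htN : σ ^ 2 * (t * (t * N)) = q := by
    rw [ht]
    have h1 := Real.mul_self_sqrt hN0.le
    have h2 := Real.mul_self_sqrt hq0.le
    rw [← h1, Real.sqrt_mul_self hsN.le]
    field_simp
    rw [sq, h2]
  have htq : q = t * (σ * √N * √q) := by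
    rw [ht]
    have h2 := Real.mul_self_sqrt hq0.le
    field_simp
    rw [sq, h2]
  have hdot : ξ ω ⬝ᵥ v ≤ (2 + 7 / 2 * Real.log 2) * (σ * √n) * A + 2 * (σ * √N * √q) := by
    rw [hcoef, htN] at hmain
    refine le_of_mul_le_mul_left ?_ ht0
    linarith
  have hsq : √q ≤ 2 * (√(Real.pi / 2) + √(2 * L)) := by
    have h1 : 1 ≤ √(Real.pi / 2) := Real.one_le_sqrt.2 (by linarith [Real.pi_gt_three])
    have h2 := Real.sq_sqrt (by positivity : 0 ≤ 2 * L)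
    have h3 := Real.sqrt_nonneg (2 * L)
    rw [Real.sqrt_le_left (by positivity)]
    nlinarith
  have hGn : √N * (√(Real.pi / 2) + √(2 * L)) = n * G := by
    have h1 : empNorm v = √N / √n := by
      rw [empNorm, ← Real.sqrt_div hN0.le, hN, one_div, inv_mul_eq_div]
      simp only [dotProduct, sq]
    rw [hG, h1]
    field_simp
    rw [sq, hsnn]
  have hbound : ξ ω ⬝ᵥ v ≤ n * (6 * σ * H + 4 * σ * G) := by
    have h1 : (2 + 7 / 2 * Real.log 2) * (σ * √n) * A ≤ 6 * σ * (n * H) := by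
      have hA0 : 0 ≤ A := Finset.sum_nonneg fun j _ => by positivity
      calc _ ≤ 4.5 * (σ * √n) * A := by gcongr; linarith
        _ ≤ 6 * (σ * √n) * (0.8 * A) := by
            have : 0 ≤ σ * √n * A := by positivity
            linarith
        _ ≤ 6 * (σ * √n) * (√n * H) := by gcongr
        _ = 6 * σ * (√n * √n * H) := by ring
        _ = _ := by rw [hsnn]
    have h2 : 2 * (σ * √N * √q) ≤ 4 * σ * (n * G) := by
      calc _ ≤ 2 * (σ * √N * (2 * (√(Real.pi / 2) + √(2 * L)))) := by gcongr
        _ = 4 * σ * (√N * (√(Real.pi / 2) + √(2 * L))) := by ring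
        _ = _ := by rw [hGn]
    linarith
  rw [one_div, inv_mul_le_iff₀ hn']
  refine hbound.trans (mul_le_mul_of_nonneg_left ?_ hn'.le)
  have h1 := mul_le_mul_of_nonneg_left (le_max_left H G) hσ.le
  have h2 := mul_le_mul_of_nonneg_left (le_max_right H G) hσ.le
  have h3 : 0 ≤ σ * max H G := mul_nonneg hσ.le (hG0.trans (le_max_right _ _))
  linarith
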